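/- Let $n\ge 1$ and let $e_1,\dots,e_n$ be the standard basis of $\mathbb{C}^n$. Let $B_{n-1}\subset GL(n)$ be the group of block diagonal matrices $\mathrm{diag}(h,1)$ with $h\in GL(n-1)$ invertible upper triangular, acting on the set $\mathcal{B}_n$ of full flags $V_1\subset\dots\subset V_n=\mathbb{C}^n$, $\dim V_i=i$. Write $(v_1\subset\dots\subset v_n)$ for the flag with $V_i=\mathrm{span}\{v_1,\dots,v_i\}$, and for $j\le n-1$ let $\hat e_j=e_j+e_n$ be the hat vector of index $j$. A full flag is in standard form if it can be written as $(v_1\subset\dots\subset v_n)$ where each $v_i$ is a standard basis vector $e_{j_i}$ ($1\le j_i\le n$) or a hat vector $\hat e_{j_i}$ ($1\le j_i\le n-1$), and (a) $v_i=e_n$ for some $i$; (b) if $v_i=e_n$, then for every $k>i$ the vector $v_k$ is a standard basis vector; (c) if $i<k$, $v_i=\hat e_{j_i}$ and $v_k=\hat e_{j_k}$, then $j_i>j_k$. Then: 1. Every $B_{n-1}$-orbit on $\mathcal{B}_n$ contains exactly one flag in standard form. 2. Equivalently, the map $\Psi:\mathcal F\mapsto B_{n-1}\cdot\mathcal F$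 is a bijection from the set of flags in standard form onto the set $B_{n-1}\backslash\mathcal{B}_n$ of orbits. 3. Let $PIL(n)$ be the set of partitions of $\{1,\dots,n\}$ into nonempty lists, i.e. set partitions together with a linear ordering of each block. Given $\Sigma\in PIL(n)$, order its lists as $\sigma_1,\dots,\sigma_t$ so that $n$ occurs in $\sigma_t$ and the last entries of $\sigma_1,\dots,\sigma_{t-1}$ are strictly decreasing, and let $\Gamma(\Sigma)=(v_1\subset\dots\subset v_n)$, where $v_1,\dots,v_n$ is obtained from the concatenation $\sigma_1\sigma_2\cdots\sigma_t$ by replacing the last entry $a$ of each of $\sigma_1,\dots,\sigma_{t-1}$ by $\hat e_a$ and every other entry $b$ by $e_b$. Then $\Gamma$ is a well-defined bijection from $PIL(n)$ onto the set of flags in standard form, and hence $\Psi\circ\Gamma$ is a bijection from $PIL(n)$ onto $B_{n-1}\backslash\mathcal{B}_n$. -/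

import Mathlib

noncomputable section

namespace StdFlags

/-- A full flag `V_1 ⊂ ⋯ ⊂ V_n` in `ℂ^n`; with 0-based indices, `V i` has dimension `i + 1`. -/
@[ext]
structure FullFlag (n : ℕ) where
  V : Fin n → Submodule ℂ (Fin n → ℂ)
  mono : Monotone V
  finrank_eq : ∀ i, Module.finrank ℂ (V i) = (i : ℕ) + 1

/-- `GL(n)` acts on full flags by `g • (V_1 ⊂ ⋯ ⊂ V_n) = (g V_1 ⊂ ⋯ ⊂ g V_n)`. -/
instance (n : ℕ) : MulAction (Matrix.GeneralLinearGroup (Fin n) ℂ) (FullFlag n) where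
  smul g F :=
    { V := fun i => (F.V i).map (Matrix.mulVecLin (g : Matrix (Fin n) (Fin n) ℂ))
      mono := fun _ _ h => Submodule.map_mono (F.mono h)
      finrank_eq := fun i => by
        rw [← F.finrank_eq i]
        refine (Submodule.equivMapOfInjective _ ?_ (F.V i)).finrank_eq.symm
        intro x y h
        simp only [Matrix.mulVecLin_apply] at h
        exact Matrix.mulVec_injective_of_isUnit g.isUnit h }
  one_smul F := by
    ext1
    funext i
    change (F.V i).map (Matrix.mulVecLin (1 : Matrix (Fin n) (Fin n) ℂ)) = F.V i
    rw [Matrix.mulVecLin_one, Submodule.map_id]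
  mul_smul g h F := by
    ext1
    funext i
    change (F.V i).map (Matrix.mulVecLin ((g : Matrix (Fin n) (Fin n) ℂ) * (h : Matrix (Fin n) (Fin n) ℂ))) =
      ((F.V i).map (Matrix.mulVecLin (h : Matrix (Fin n) (Fin n) ℂ))).map
        (Matrix.mulVecLin (g : Matrix (Fin n) (Fin n) ℂ))
    rw [Matrix.mulVecLin_mul, Submodule.map_comp]

/-- The Borel subgroup `B_n` of upper triangular matrices in `GL(n)`. -/
def upperBorel (n : ℕ) : Subgroup (Matrix.GeneralLinearGroup (Fin n) ℂ) where
  carrier := {g | (g : Matrix (Fin n) (Fin n) ℂ).BlockTriangular id}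
  mul_mem' ha hb := Matrix.BlockTriangular.mul ha hb
  one_mem' := Matrix.blockTriangular_one
  inv_mem' {g} hg := by
    have := g.invertible
    have h := Matrix.blockTriangular_inv_of_blockTriangular
      (M := (g : Matrix (Fin n) (Fin n) ℂ)) hg
    simpa using h

/-- The standard basis vector `e_j` of `ℂ^n`. -/
def stdVec {n : ℕ} (j : Fin n) : Fin n → ℂ := Pi.single j 1

/-- For `n = m + 1`, the vector `ê_j = e_j + e_n`; it is a hat vector when `j < n`. -/
def hatVec {m : ℕ} (j : Fin (m + 1)) : Fin (m + 1) → ℂ := stdVec j + stdVec (Fin.last m)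

/-- For `n = m + 1`, the copy of `GL(n-1)` in `GL(n)` consisting of the block diagonal matrices
`diag(h, 1)`, i.e. the matrices whose last column and last row are those of the identity. -/
def blockGL (m : ℕ) : Subgroup (Matrix.GeneralLinearGroup (Fin (m + 1)) ℂ) where
  carrier := {g |
    Matrix.mulVec (g : Matrix (Fin (m + 1)) (Fin (m + 1)) ℂ) (stdVec (Fin.last m)) =
      stdVec (Fin.last m) ∧
    Matrix.vecMul (stdVec (Fin.last m)) (g : Matrix (Fin (m + 1)) (Fin (m + 1)) ℂ) =
      stdVec (Fin.last m)}
  mul_mem' {a b} ha hb := by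
    refine ⟨?_, ?_⟩
    · rw [Matrix.GeneralLinearGroup.coe_mul, ← Matrix.mulVec_mulVec, hb.1, ha.1]
    · rw [Matrix.GeneralLinearGroup.coe_mul, ← Matrix.vecMul_vecMul, ha.2, hb.2]
  one_mem' := by simp
  inv_mem' {g} hg := by
    have h1 : ((g⁻¹ : Matrix.GeneralLinearGroup (Fin (m + 1)) ℂ) :
        Matrix (Fin (m + 1)) (Fin (m + 1)) ℂ) * g = 1 := by
      rw [← Matrix.GeneralLinearGroup.coe_mul, inv_mul_cancel]; rfl
    have h2 : (g : Matrix (Fin (m + 1)) (Fin (m + 1)) ℂ) *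
        ((g⁻¹ : Matrix.GeneralLinearGroup (Fin (m + 1)) ℂ) :
          Matrix (Fin (m + 1)) (Fin (m + 1)) ℂ) = 1 := by
      rw [← Matrix.GeneralLinearGroup.coe_mul, mul_inv_cancel]; rfl
    refine ⟨?_, ?_⟩
    · conv_lhs => rw [← hg.1]
      rw [Matrix.mulVec_mulVec, h1, Matrix.one_mulVec]
    · conv_lhs => rw [← hg.2]
      rw [Matrix.vecMul_vecMul, h2, Matrix.vecMul_one]

/-- For `n = m + 1`, the group `B_{n-1} = GL(n-1) ∩ B_n`, a subgroup of `GL(n)`. -/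
def smallBorel (m : ℕ) : Subgroup (Matrix.GeneralLinearGroup (Fin (m + 1)) ℂ) :=
  blockGL m ⊓ upperBorel (m + 1)

/-- `F = (v_1 ⊂ v_2 ⊂ ⋯ ⊂ v_n)`, i.e. `V_i = span {v_1, …, v_i}` for all `i`. -/
def FullFlag.IsSpannedBy {n : ℕ} (F : FullFlag n) (v : Fin n → (Fin n → ℂ)) : Prop :=
  ∀ i, F.V i = Submodule.span ℂ (v '' Set.Iic i)

/-- The flag `F` in `ℂ^n`, `n = m + 1`, is in standard form. -/
def IsStandard {m : ℕ} (F : FullFlag (m + 1)) : Prop :=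
  ∃ v : Fin (m + 1) → (Fin (m + 1) → ℂ),
    F.IsSpannedBy v ∧
    (∀ i, (∃ j, v i = stdVec j) ∨ (∃ j, j < Fin.last m ∧ v i = hatVec j)) ∧
    (∃ i, v i = stdVec (Fin.last m)) ∧
    (∀ i k, v i = stdVec (Fin.last m) → i < k → ∃ j, v k = stdVec j) ∧
    (∀ i k, i < k → ∀ j l, j < Fin.last m → l < Fin.last m →
      v i = hatVec j → v k = hatVec l → l < j)

/-- The set of flags in standard form. -/
abbrev StandardFlag (m : ℕ) : Type := {F : FullFlag (m + 1) // IsStandard F}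

/-- The set `B_{n-1} \ 𝓑_n` of `B_{n-1}`-orbits on the variety of full flags, `n = m + 1`. -/
abbrev Orbits (m : ℕ) : Type :=
  MulAction.orbitRel.Quotient (smallBorel m) (FullFlag (m + 1))

/-- The map `F ↦ B_{n-1} · F` from flags in standard form to orbits. -/
def toOrbit {m : ℕ} (F : StandardFlag m) : Orbits m :=
  Quotient.mk (MulAction.orbitRel (smallBorel m) (FullFlag (m + 1))) F.1

/-- A partition of the set `{1, …, n}` (here `Fin n`) into (nonempty) lists. -/
@[ext]
structure PIL (n : ℕ) where
  lists : Finset (List (Fin n))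
  ne_nil : ∀ σ ∈ lists, σ ≠ []
  nodup : ∀ σ ∈ lists, σ.Nodup
  existsUnique_mem : ∀ a, ∃! σ, σ ∈ lists ∧ a ∈ σ

/-- The flag `F` is the one attached to the partition into lists `S`. The lists of `S` are ordered
as `σ_1, …, σ_t` with `n ∈ σ_t = τ` and with the last entries of `σ_1, …, σ_{t-1}` decreasing;
`L` records, for each of `σ_1, …, σ_{t-1}`, the pair (initial part, last entry).
Then `F = (v_1 ⊂ ⋯ ⊂ v_n)`, where `(v_1, …, v_n)` is obtained from the concatenation
`σ_1 σ_2 ⋯ σ_t` by replacing the last entry `a` of each of `σ_1, …, σ_{t-1}` by `ê_a` and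
every other entry `b` by `e_b`. -/
def IsFlagOfPIL {m : ℕ} (S : PIL (m + 1)) (F : FullFlag (m + 1)) : Prop :=
  ∃ (L : List (List (Fin (m + 1)) × Fin (m + 1))) (τ : List (Fin (m + 1)))
    (v : Fin (m + 1) → (Fin (m + 1) → ℂ)),
    S.lists.val = ((L.map (fun p => p.1 ++ [p.2]) ++ [τ] : List (List (Fin (m + 1)))) :
      Multiset (List (Fin (m + 1)))) ∧
    Fin.last m ∈ τ ∧
    L.Pairwise (fun p q => q.2 < p.2) ∧
    List.ofFn v = L.flatMap (fun p => p.1.map stdVec ++ [hatVec p.2]) ++ τ.map stdVec ∧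
    F.IsSpannedBy v

end StdFlags

end

/-! Order the coordinates as n, 1, …, n-1 (this is `key`). The group `B_{n-1}` consists of the
invertible matrices that preserve the coordinate flag `⟨e_n⟩ ⊂ ⟨e_n, e_1⟩ ⊂ ⋯`, fix `e_n` and fix
the functional `x ↦ x_n`. Call the largest `key` of a nonzero coordinate of `x` its lead. A standard
flag is encoded by a word of letters `e_a`, `ê_a` whose indices form a permutation. Letters with
nonzero last coordinate are marked, and since `e_n` has the least key, (b) and (c) together say that
the keys of marked letters strictly decrease (`IsAdmissible`).

Uniqueness: the leads of vectors in `V_i` outside `V_{i-1}`, and the leads of vectors in `V_i` with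
`x_n ≠ 0`, are orbit invariants. The least lead of the first kind is the key of the i-th letter, and
marked letters are where the least lead of the second kind drops (`freshLead_iff`, `marked_iff`,
`word_unique`).

Existence: choose new vectors of `V_i` with minimal lead; these leads are distinct. Rescaling, or
subtracting earlier vectors, makes each last coordinate 1 or 0 according to the drops just
described. The resulting vectors are the images of an admissible word under one element of `B_{n-1}`
(`exists_admissible`).

Partitions: cutting an admissible word after each hat gives the lists in the prescribed order, and
this is reversible. -/

namespace StdFlags

/-! ### Letters, words and the order of coordinates -/

variable {m : ℕ}

/-- The order of the coordinates in which the last one comes first. -/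
def key (a : Fin (m + 1)) : Fin (m + 1) := finRotate (m + 1) a

theorem key_injective : Function.Injective (key : Fin (m + 1) → Fin (m + 1)) :=
  (finRotate (m + 1)).injective

theorem key_last : key (Fin.last m) = 0 := finRotate_last

theorem key_symm (j : Fin (m + 1)) : key ((finRotate (m + 1)).symm j) = j :=
  (finRotate (m + 1)).apply_symm_apply j

theorem key_val {a : Fin (m + 1)} (h : a ≠ Fin.last m) : (key a : ℕ) = a + 1 :=
  coe_finRotate_of_ne_last h

theorem key_lt_key {a b : Fin (m + 1)} (ha : a ≠ Fin.last m) (hb : b ≠ Fin.last m) :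
    key a < key b ↔ a < b := by
  rw [Fin.lt_def, Fin.lt_def, key_val ha, key_val hb]; omega

theorem key_pos {a : Fin (m + 1)} (ha : a ≠ Fin.last m) : 0 < key a := by
  rw [Fin.lt_def, key_val ha]; simp

theorem not_lt_key_last (j : Fin (m + 1)) : ¬ j < key (Fin.last m) := by
  rw [key_last]; exact Fin.not_lt_zero j

/-- A letter `(a, b)` stands for `e_a` if `b` is false and for `ê_a` if `b` is true. -/
def letterVec (x : Fin (m + 1) × Bool) : Fin (m + 1) → ℂ :=
  if x.2 then hatVec x.1 else stdVec x.1

/-- The letters whose vector has a nonzero last coordinate. -/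
def Marked (x : Fin (m + 1) × Bool) : Prop := x.2 = true ∨ x.1 = Fin.last m

theorem letterVec_apply_of_ne (x : Fin (m + 1) × Bool) {l : Fin (m + 1)} (hl : l ≠ Fin.last m) :
    letterVec x l = if x.1 = l then 1 else 0 := by
  have h : stdVec x.1 l = if x.1 = l then (1 : ℂ) else 0 := by
    simp [stdVec, Pi.single_apply, eq_comm]
  have h' : stdVec (Fin.last m) l = 0 := by simp [stdVec, hl]
  unfold letterVec hatVec
  split_ifs with h1 <;> simp_all

/-- The pair for `ê_n` is excluded because it would stand for `2 e_n`. -/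
theorem letterVec_apply_last {x : Fin (m + 1) × Bool} (hx : x ≠ (Fin.last m, true)) [Decidable (Marked x)] :
    letterVec x (Fin.last m) = if Marked x then 1 else 0 := by
  obtain ⟨a, b⟩ := x
  unfold letterVec hatVec stdVec
  cases b <;> simp [Marked, Pi.single_apply] at hx ⊢
  · simp [eq_comm]
  · exact fun h => hx h.symm

/-- The words whose vectors span a flag in standard form. -/
structure IsAdmissible (w : Fin (m + 1) → Fin (m + 1) × Bool) : Prop where
  inj : Function.Injective fun i => (w i).1
  ne_hat_last : ∀ i, w i ≠ (Fin.last m, true)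
  anti : ∀ i k, i < k → Marked (w i) → Marked (w k) → key (w k).1 < key (w i).1

/-- The coordinates after the `j`-th one, in the order given by `key`, vanish. -/
def LeadLE (x : Fin (m + 1) → ℂ) (j : Fin (m + 1)) : Prop := ∀ l, j < key l → x l = 0

/-! ### Fresh vectors and spanning families of a full flag -/

/-- `x` belongs to `V_i` but to no smaller member of the full flag `0 ⊂ V_1 ⊂ ⋯ ⊂ V_n`. -/
structure FullFlag.Fresh {n : ℕ} (F : FullFlag n) (i : Fin n) (x : Fin n → ℂ) : Prop where
  mem : x ∈ F.V i
  -- Only needed for the first index, where there is no smaller `V k` to contain 0.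
  ne_zero : x ≠ 0
  notMem : ∀ k < i, x ∉ F.V k

namespace FullFlag

variable {n : ℕ} {F : FullFlag n}

theorem Fresh.sub {i k : Fin n} {x y : Fin n → ℂ} (hx : F.Fresh i x) (hk : k < i) (hy : y ∈ F.V k) :
    F.Fresh i (x - y) where
  mem := sub_mem hx.mem (F.mono hk.le hy)
  ne_zero h := hx.notMem k hk (by rwa [sub_eq_zero.1 h])
  notMem l hl h := hx.notMem (max k l) (max_lt hk hl) (by
    have := add_mem (F.mono (le_max_right k l) h) (F.mono (le_max_left k l) hy)
    simpa using this)

theorem Fresh.smul {i : Fin n} {x : Fin n → ℂ} (hx : F.Fresh i x) {c : ℂ} (hc : c ≠ 0) :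
    F.Fresh i (c • x) where
  mem := Submodule.smul_mem _ c hx.mem
  ne_zero := smul_ne_zero hc hx.ne_zero
  notMem l hl h := hx.notMem l hl ((Submodule.smul_mem_iff _ hc).1 h)

theorem V_lt {i k : Fin n} (h : i < k) : F.V i < F.V k := by
  refine lt_of_le_of_ne (F.mono h.le) fun he => ?_
  have h1 := F.finrank_eq i
  rw [he, F.finrank_eq k] at h1
  have : (i : ℕ) < k := h
  omega

theorem exists_fresh (F : FullFlag n) (i : Fin n) : ∃ x, F.Fresh i x := by
  obtain ⟨i, hi⟩ := i
  cases i with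
  | zero =>
    have hne : F.V ⟨0, hi⟩ ≠ ⊥ := fun h => by
      have := F.finrank_eq ⟨0, hi⟩
      rw [h] at this
      simp at this
    obtain ⟨x, hx, hx0⟩ := Submodule.exists_mem_ne_zero_of_ne_bot hne
    exact ⟨x, hx, hx0, fun k hk => absurd hk (by simp [Fin.lt_def])⟩
  | succ i =>
    have hlt : F.V ⟨i, by omega⟩ < F.V ⟨i + 1, hi⟩ := V_lt (by simp [Fin.lt_def])
    obtain ⟨x, hx, hx'⟩ := SetLike.exists_of_lt hlt
    refine ⟨x, hx, fun h => hx' (h ▸ zero_mem _), fun k hk h => hx' (F.mono ?_ h)⟩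
    simp only [Fin.lt_def, Fin.le_def] at hk ⊢
    omega

/-- Each fresh vector strictly enlarges the span of its predecessors, so the i-th span reaches the
dimension of `V i`, in which it is contained. -/
theorem isSpannedBy_of_fresh {v : Fin n → Fin n → ℂ} (hv : ∀ i, F.Fresh i (v i)) :
    F.IsSpannedBy v := by
  have hle : ∀ i, Submodule.span ℂ (v '' Set.Iic i) ≤ F.V i := fun i => by
    rw [Submodule.span_le]
    rintro _ ⟨k, hk, rfl⟩
    exact F.mono hk (hv k).mem
  have hfin : ∀ (i : ℕ) (hi : i < n),
      i + 1 ≤ Module.finrank ℂ (Submodule.span ℂ (v '' Set.Iic (⟨i, hi⟩ : Fin n))) := by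
    intro i
    induction i with
    | zero =>
      intro hi
      rw [Nat.succ_le_iff, Module.finrank_pos_iff_exists_ne_zero]
      exact ⟨⟨v ⟨0, hi⟩, Submodule.subset_span ⟨_, Set.mem_Iic.2 le_rfl, rfl⟩⟩,
        fun h => (hv _).ne_zero (congrArg Subtype.val h)⟩
    | succ i ih =>
      intro hi
      have hlt : Submodule.span ℂ (v '' Set.Iic (⟨i, by omega⟩ : Fin n)) <
          Submodule.span ℂ (v '' Set.Iic (⟨i + 1, hi⟩ : Fin n)) := by
        refine lt_of_le_of_ne (Submodule.span_mono (Set.image_mono (Set.Iic_subset_Iic.2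
          (by simp [Fin.le_def])))) fun he => ?_
        refine (hv ⟨i + 1, hi⟩).notMem ⟨i, by omega⟩ (by simp [Fin.lt_def]) (hle _ ?_)
        rw [he]
        exact Submodule.subset_span ⟨_, Set.mem_Iic.2 le_rfl, rfl⟩
      have := Submodule.finrank_lt_finrank_of_lt hlt
      have := ih (by omega)
      omega
  intro i
  refine (Submodule.eq_of_le_of_finrank_le (hle i) ?_).symm
  rw [F.finrank_eq]
  exact hfin i i.2

theorem IsSpannedBy.unique {F' : FullFlag n} {v : Fin n → Fin n → ℂ} (h : F.IsSpannedBy v)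
    (h' : F'.IsSpannedBy v) : F = F' := by
  ext1
  funext i
  rw [h i, h' i]

theorem IsSpannedBy.mem_iff {v : Fin n → Fin n → ℂ} (h : F.IsSpannedBy v) {i : Fin n}
    {x : Fin n → ℂ} :
    x ∈ F.V i ↔ ∃ c : Fin n → ℂ, (∀ k, i < k → c k = 0) ∧ x = ∑ k, c k • v k := by
  rw [h i]
  constructor
  · intro hx
    induction hx using Submodule.span_induction with
    | mem x hx =>
      obtain ⟨k, hk, rfl⟩ := hx
      refine ⟨Pi.single k 1, fun l hl => ?_, ?_⟩
      · rw [Pi.single_apply, if_neg]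
        rintro rfl
        exact absurd hl (not_lt.2 hk)
      · simp [Pi.single_apply]
    | zero => exact ⟨0, by simp, by simp⟩
    | add x y _ _ hx hy =>
      obtain ⟨c, hc, rfl⟩ := hx
      obtain ⟨d, hd, rfl⟩ := hy
      exact ⟨c + d, fun k hk => by simp [hc k hk, hd k hk], by
        simp [add_smul, Finset.sum_add_distrib]⟩
    | smul a x _ hx =>
      obtain ⟨c, hc, rfl⟩ := hx
      exact ⟨a • c, fun k hk => by simp [hc k hk], by simp [Finset.smul_sum, mul_smul]⟩
  · rintro ⟨c, hc, rfl⟩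
    refine Submodule.sum_mem _ fun k _ => ?_
    by_cases hk : i < k
    · simp [hc k hk]
    · exact Submodule.smul_mem _ _ (Submodule.subset_span ⟨k, not_lt.1 hk, rfl⟩)

/-- Without its i-th term the sum would already lie in the preceding member of the flag, or be 0. -/
theorem IsSpannedBy.fresh_coeff_ne_zero {v : Fin n → Fin n → ℂ} (h : F.IsSpannedBy v) {i : Fin n}
    {c : Fin n → ℂ} (hc : ∀ k, i < k → c k = 0) (hx : F.Fresh i (∑ k, c k • v k)) : c i ≠ 0 := by
  intro hi
  obtain ⟨i, hin⟩ := i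
  cases i with
  | zero =>
    refine hx.ne_zero (Finset.sum_eq_zero fun k _ => ?_)
    rcases eq_or_ne k ⟨0, hin⟩ with rfl | hk
    · simp [hi]
    · rw [hc k (lt_of_le_of_ne (by simp [Fin.le_def]) hk.symm), zero_smul]
  | succ i =>
    refine hx.notMem ⟨i, by omega⟩ (by simp [Fin.lt_def]) (h.mem_iff.2 ⟨c, fun k hk => ?_, rfl⟩)
    rcases eq_or_ne k ⟨i + 1, hin⟩ with rfl | hk'
    · exact hi
    · refine hc k (lt_of_le_of_ne ?_ hk'.symm)
      simp only [Fin.lt_def, Fin.le_def] at hk ⊢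
      omega

theorem exists_isSpannedBy {v : Fin n → Fin n → ℂ} (hv : LinearIndependent ℂ v) :
    ∃ F : FullFlag n, F.IsSpannedBy v := by
  refine ⟨⟨fun i => Submodule.span ℂ (v '' Set.Iic i),
    fun i k h => Submodule.span_mono (Set.image_mono (Set.Iic_subset_Iic.2 h)), fun i => ?_⟩,
    fun i => rfl⟩
  have h := finrank_span_eq_card (hv.comp ((↑) : Set.Iic i → Fin n) Subtype.val_injective)
  rw [Set.range_comp, Subtype.range_coe] at h
  rw [h, Fintype.card_congr (Equiv.setCongr rfl : Set.Iic i ≃ Set.Iic i)]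
  simp

theorem IsSpannedBy.fresh {v : Fin n → Fin n → ℂ} (h : F.IsSpannedBy v)
    (hv : LinearIndependent ℂ v) (i : Fin n) : F.Fresh i (v i) where
  mem := by rw [h i]; exact Submodule.subset_span ⟨i, Set.mem_Iic.2 le_rfl, rfl⟩
  ne_zero := hv.ne_zero i
  notMem k hk := by
    rw [h k]
    exact hv.notMem_span_image (by simpa using hk)

theorem IsSpannedBy.smul {v : Fin n → Fin n → ℂ} (h : F.IsSpannedBy v)
    (g : Matrix.GeneralLinearGroup (Fin n) ℂ) :
    (g • F).IsSpannedBy fun i => (g : Matrix (Fin n) (Fin n) ℂ).mulVec (v i) := by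
  intro i
  change (F.V i).map (Matrix.mulVecLin (g : Matrix (Fin n) (Fin n) ℂ)) = _
  rw [h i, Submodule.map_span, Set.image_image]
  rfl

theorem mulVec_mem_smul {g : Matrix.GeneralLinearGroup (Fin n) ℂ} {i : Fin n} {x : Fin n → ℂ} :
    (g : Matrix (Fin n) (Fin n) ℂ).mulVec x ∈ (g • F).V i ↔ x ∈ F.V i := by
  change _ ∈ (F.V i).map (Matrix.mulVecLin (g : Matrix (Fin n) (Fin n) ℂ)) ↔ _
  constructor
  · rintro ⟨y, hy, hxy⟩
    rw [← Matrix.mulVec_injective_of_isUnit g.isUnit hxy]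
    exact hy
  · exact fun hx => ⟨x, hx, rfl⟩

theorem Fresh.smul_mulVec {i : Fin n} {x : Fin n → ℂ} (hx : F.Fresh i x)
    (g : Matrix.GeneralLinearGroup (Fin n) ℂ) :
    (g • F).Fresh i ((g : Matrix (Fin n) (Fin n) ℂ).mulVec x) where
  mem := mulVec_mem_smul.2 hx.mem
  ne_zero h := hx.ne_zero (Matrix.mulVec_injective_of_isUnit g.isUnit (by
    rw [h]; exact (Matrix.mulVec_zero _).symm))
  notMem k hk h := hx.notMem k hk (mulVec_mem_smul.1 h)

end FullFlag

/-! ### Orbit invariants -/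

theorem leadLE_zero_iff {x : Fin (m + 1) → ℂ} :
    LeadLE x 0 ↔ ∀ l, l ≠ Fin.last m → x l = 0 := by
  refine ⟨fun h l hl => h l (key_pos hl), fun h l hl => h l ?_⟩
  rintro rfl
  exact not_lt_key_last _ hl

theorem smallBorel_mulVec_last {g : Matrix.GeneralLinearGroup (Fin (m + 1)) ℂ}
    (hg : g ∈ smallBorel m) (x : Fin (m + 1) → ℂ) :
    (g : Matrix (Fin (m + 1)) (Fin (m + 1)) ℂ).mulVec x (Fin.last m) = x (Fin.last m) := by
  have h := congrArg (fun r => dotProduct r x) hg.1.2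
  simp only [← Matrix.dotProduct_mulVec] at h
  simpa [stdVec] using h

/-- The last column of `g` is `e_n` and the other columns are upper triangular, so `g` preserves the
coordinate flag in the order given by `key`. -/
theorem LeadLE.mulVec {g : Matrix.GeneralLinearGroup (Fin (m + 1)) ℂ}
    (hg : g ∈ smallBorel m) {x : Fin (m + 1) → ℂ} {j : Fin (m + 1)} (hx : LeadLE x j) :
    LeadLE ((g : Matrix (Fin (m + 1)) (Fin (m + 1)) ℂ).mulVec x) j := by
  intro l hl
  have hl' : l ≠ Fin.last m := by
    rintro rfl
    exact not_lt_key_last _ hl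
  rw [Matrix.mulVec_eq_sum, Finset.sum_apply]
  refine Finset.sum_eq_zero fun a _ => ?_
  simp only [Pi.smul_apply, MulOpposite.smul_eq_mul_unop, MulOpposite.unop_op,
    Matrix.transpose_apply]
  rcases eq_or_ne a (Fin.last m) with rfl | ha
  · have h := congrFun hg.1.1 l
    simp only [stdVec, Matrix.mulVec_single_one, Matrix.col_apply, Pi.single_apply, if_neg hl'] at h
    rw [h, zero_mul]
  · rcases lt_or_ge a l with hal | hal
    · rw [hg.2 hal, zero_mul]
    · rw [hx a, mul_zero]
      refine hl.trans_le ?_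
      rw [Fin.le_def, key_val hl', key_val ha]
      simpa using hal

/-- The first invariant of an orbit, which detects the index of the `i`-th letter. -/
def FreshLead (F : FullFlag (m + 1)) (i j : Fin (m + 1)) : Prop := ∃ x, F.Fresh i x ∧ LeadLE x j

/-- The second invariant of an orbit, which detects the marked letters. -/
def LastLead (F : FullFlag (m + 1)) (i j : Fin (m + 1)) : Prop :=
  ∃ x ∈ F.V i, x (Fin.last m) ≠ 0 ∧ LeadLE x j

theorem FreshLead.smul {F : FullFlag (m + 1)} {i j : Fin (m + 1)} (h : FreshLead F i j)
    {g : Matrix.GeneralLinearGroup (Fin (m + 1)) ℂ} (hg : g ∈ smallBorel m) :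
    FreshLead (g • F) i j := by
  obtain ⟨x, hx, hj⟩ := h
  exact ⟨_, hx.smul_mulVec g, hj.mulVec hg⟩

theorem LastLead.smul {F : FullFlag (m + 1)} {i j : Fin (m + 1)} (h : LastLead F i j)
    {g : Matrix.GeneralLinearGroup (Fin (m + 1)) ℂ} (hg : g ∈ smallBorel m) :
    LastLead (g • F) i j := by
  obtain ⟨x, hx, hx', hj⟩ := h
  exact ⟨_, FullFlag.mulVec_mem_smul.2 hx, by rwa [smallBorel_mulVec_last hg], hj.mulVec hg⟩

theorem freshLead_smul_iff {F : FullFlag (m + 1)} {i j : Fin (m + 1)}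
    {g : Matrix.GeneralLinearGroup (Fin (m + 1)) ℂ} (hg : g ∈ smallBorel m) :
    FreshLead (g • F) i j ↔ FreshLead F i j :=
  ⟨fun h => by simpa using h.smul (inv_mem hg), fun h => h.smul hg⟩

theorem lastLead_smul_iff {F : FullFlag (m + 1)} {i j : Fin (m + 1)}
    {g : Matrix.GeneralLinearGroup (Fin (m + 1)) ℂ} (hg : g ∈ smallBorel m) :
    LastLead (g • F) i j ↔ LastLead F i j :=
  ⟨fun h => by simpa using h.smul (inv_mem hg), fun h => h.smul hg⟩

/-! ### The invariants determine the word -/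

/-- The vectors of a word. -/
def wordVec (w : Fin (m + 1) → Fin (m + 1) × Bool) (i : Fin (m + 1)) : Fin (m + 1) → ℂ :=
  letterVec (w i)

theorem leadLE_letterVec (x : Fin (m + 1) × Bool) : LeadLE (letterVec x) (key x.1) := by
  intro l hl
  have hl' : l ≠ Fin.last m := by
    rintro rfl
    exact not_lt_key_last _ hl
  rw [letterVec_apply_of_ne x hl', if_neg]
  rintro rfl
  exact lt_irrefl _ hl

namespace IsAdmissible

variable {w : Fin (m + 1) → Fin (m + 1) × Bool}

theorem bijective (hw : IsAdmissible w) : Function.Bijective fun i => (w i).1 :=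
  Finite.injective_iff_bijective.1 hw.inj

/-- Distinct letters have distinct indices, and a hat only affects the last coordinate, so
coefficients can be read off as coordinates. -/
theorem sum_apply (hw : IsAdmissible w) (c : Fin (m + 1) → ℂ) {i : Fin (m + 1)}
    (hi : (w i).1 ≠ Fin.last m) : (∑ k, c k • wordVec w k) (w i).1 = c i := by
  rw [Finset.sum_apply, Finset.sum_eq_single i]
  · simp [wordVec, letterVec_apply_of_ne _ hi]
  · intro k _ hk
    simp [wordVec, letterVec_apply_of_ne _ hi, hw.inj.ne_iff.2 hk]
  · simp

open Classical in
theorem sum_apply_last (hw : IsAdmissible w) (c : Fin (m + 1) → ℂ) :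
    (∑ k, c k • wordVec w k) (Fin.last m) = ∑ k, if Marked (w k) then c k else 0 := by
  rw [Finset.sum_apply]
  refine Finset.sum_congr rfl fun k _ => ?_
  simp [wordVec, letterVec_apply_last (hw.ne_hat_last k)]

theorem linearIndependent (hw : IsAdmissible w) : LinearIndependent ℂ (wordVec w) := by
  classical
  rw [Fintype.linearIndependent_iff]
  intro c hc
  have h1 : ∀ i, (w i).1 ≠ Fin.last m → c i = 0 := fun i hi => by
    rw [← hw.sum_apply c hi, hc]; rfl
  intro i
  by_cases hi : (w i).1 = Fin.last m
  · have h := hw.sum_apply_last c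
    rw [hc, Finset.sum_eq_single i, if_pos (show Marked (w i) from Or.inr hi)] at h
    · exact h.symm
    · intro k _ hk
      rw [h1 k fun h => hk (hw.inj (h.trans hi.symm)), ite_self]
    · simp
  · exact h1 i hi

/-- A fresh vector has a nonzero i-th coefficient, which shows up as its coordinate at the index of
the i-th letter; the letter itself attains the bound. -/
theorem freshLead_iff (hw : IsAdmissible w) {F : FullFlag (m + 1)} (hF : F.IsSpannedBy (wordVec w))
    {i j : Fin (m + 1)} : FreshLead F i j ↔ key (w i).1 ≤ j := by
  constructor
  · rintro ⟨x, hx, hj⟩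
    obtain ⟨c, hc, rfl⟩ := hF.mem_iff.1 hx.mem
    have hci := hF.fresh_coeff_ne_zero hc hx
    by_contra! hlt
    refine hci ?_
    rw [← hw.sum_apply c (i := i), hj _ hlt]
    intro h
    rw [h] at hlt
    exact not_lt_key_last _ hlt
  · exact fun h => ⟨_, hF.fresh hw.linearIndependent i,
      fun l hl => leadLE_letterVec _ l (h.trans_lt hl)⟩

/-- The last coordinate is the sum of the coefficients of marked letters, so one of these is nonzero
and is visible in the lead. -/
theorem lastLead_iff (hw : IsAdmissible w) {F : FullFlag (m + 1)} (hF : F.IsSpannedBy (wordVec w))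
    {i j : Fin (m + 1)} : LastLead F i j ↔ ∃ k ≤ i, Marked (w k) ∧ key (w k).1 ≤ j := by
  classical
  constructor
  · rintro ⟨x, hx, hx', hj⟩
    obtain ⟨c, hc, rfl⟩ := hF.mem_iff.1 hx
    rw [hw.sum_apply_last] at hx'
    obtain ⟨k, -, hk⟩ := Finset.exists_ne_zero_of_sum_ne_zero hx'
    simp only [ne_eq, ite_eq_right_iff, not_forall] at hk
    obtain ⟨hk1, hk2⟩ := hk
    refine ⟨k, not_lt.1 fun h => hk2 (hc k h), hk1, not_lt.1 fun h => hk2 ?_⟩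
    rw [← hw.sum_apply c (i := k), hj _ h]
    intro h'
    rw [h'] at h
    exact not_lt_key_last _ h
  · rintro ⟨k, hk, hm, hj⟩
    refine ⟨_, F.mono hk (hF.fresh hw.linearIndependent k).mem, ?_,
      fun l hl => leadLE_letterVec _ l (hj.trans_lt hl)⟩
    simp [wordVec, letterVec_apply_last (hw.ne_hat_last k), hm]

/-- As marked keys decrease, a marked letter sets a new minimum. The right side involves only an
invariant and the letter's index, itself determined by an invariant. -/
theorem marked_iff (hw : IsAdmissible w) {F : FullFlag (m + 1)} (hF : F.IsSpannedBy (wordVec w))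
    {i : Fin (m + 1)} :
    Marked (w i) ↔ LastLead F i (key (w i).1) ∧ ∀ k < i, ¬ LastLead F k (key (w i).1) := by
  simp only [hw.lastLead_iff hF]
  constructor
  · intro hi
    refine ⟨⟨i, le_rfl, hi, le_rfl⟩, ?_⟩
    rintro k hk ⟨l, hl, hm, hle⟩
    exact absurd (hw.anti l i (hl.trans_lt hk) hm hi) (not_lt.2 hle)
  · rintro ⟨⟨k, hk, hm, hle⟩, h⟩
    rcases hk.lt_or_eq with hk | rfl
    · exact absurd ⟨k, le_rfl, hm, hle⟩ (h k hk)
    · exact hm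

theorem word_unique (hw : IsAdmissible w) {w' : Fin (m + 1) → Fin (m + 1) × Bool}
    (hw' : IsAdmissible w') {F : FullFlag (m + 1)}
    {g : Matrix.GeneralLinearGroup (Fin (m + 1)) ℂ} (hg : g ∈ smallBorel m)
    (hF : F.IsSpannedBy (wordVec w)) (hF' : (g • F).IsSpannedBy (wordVec w')) : w = w' := by
  have hfst : ∀ i, (w i).1 = (w' i).1 := fun i => by
    refine key_injective (eq_of_forall_ge_iff fun j => ?_)
    rw [← hw.freshLead_iff hF, ← hw'.freshLead_iff hF', freshLead_smul_iff hg]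
  have hmarked : ∀ i, Marked (w i) ↔ Marked (w' i) := fun i => by
    rw [hw.marked_iff hF, hw'.marked_iff hF', hfst]
    simp only [lastLead_smul_iff hg]
  funext i
  refine Prod.ext (hfst i) ?_
  by_cases hi : (w i).1 = Fin.last m
  · have h1 : (w i).2 = false := by
      by_contra h
      exact hw.ne_hat_last i (Prod.ext hi (by simpa using h))
    have h2 : (w' i).2 = false := by
      by_contra h
      exact hw'.ne_hat_last i (Prod.ext ((hfst i).symm.trans hi) (by simpa using h))
    rw [h1, h2]
  · have h := hmarked i
    simp only [Marked, ← hfst i, hi, or_false] at h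
    exact Bool.eq_iff_iff.2 h

end IsAdmissible

/-! ### Reduction to an admissible word -/

theorem exists_minimal_leads (F : FullFlag (m + 1)) :
    ∃ a : Fin (m + 1) → Fin (m + 1), Function.Injective a ∧ (∀ i, FreshLead F i (key (a i))) ∧
      ∀ i x, F.Fresh i x → LeadLE x (key (a i)) → x (a i) ≠ 0 := by
  have hne : ∀ i, ∃ j, FreshLead F i j := fun i => by
    obtain ⟨x, hx⟩ := F.exists_fresh i
    exact ⟨Fin.last m, x, hx, fun l hl => absurd hl (not_lt.2 (Fin.le_last _))⟩
  have hmin : ∀ i, ∃ j, FreshLead F i j ∧ ∀ j', FreshLead F i j' → j ≤ j' := fun i => by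
    obtain ⟨j, hj, hj'⟩ := WellFounded.has_min (wellFounded_lt (α := Fin (m + 1)))
      {j | FreshLead F i j} (hne i)
    exact ⟨j, hj, fun j' h => not_lt.1 (hj' j' h)⟩
  choose b hb hbmin using hmin
  -- If this coordinate vanished, the lead could be lowered to `b i - 1`; here `b i > 0` because `x`
  -- has some nonzero coordinate.
  have hlead : ∀ i x, F.Fresh i x → LeadLE x (b i) → x ((finRotate (m + 1)).symm (b i)) ≠ 0 := by
    intro i x hx hxb h0
    obtain ⟨l, hl⟩ := Function.ne_iff.1 hx.ne_zero
    have hlb : key l < b i := by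
      refine lt_of_le_of_ne (not_lt.1 fun h => hl (hxb l h)) fun h => hl ?_
      rw [← h] at h0
      simpa [key] using h0
    have hb1 : 0 < (b i : ℕ) := lt_of_le_of_lt (Nat.zero_le _) hlb
    have hle := hbmin i ⟨b i - 1, by omega⟩ ⟨x, hx, fun k hk => by
      rcases eq_or_ne (key k) (b i) with h | h
      · rw [← h] at h0
        simpa [key] using h0
      · refine hxb k (lt_of_le_of_ne ?_ h.symm)
        simp only [Fin.lt_def, Fin.le_def] at hk ⊢
        omega⟩
    simp only [Fin.le_def] at hle
    omega
  refine ⟨fun i => (finRotate (m + 1)).symm (b i), (Equiv.injective _).comp ?_,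
    fun i => by rw [key_symm]; exact hb i, fun i x hx h => hlead i x hx (by rwa [key_symm] at h)⟩
  suffices h : ∀ i k, i < k → b i ≠ b k from fun i k h' => by
    rcases lt_trichotomy i k with hik | hik | hik
    exacts [absurd h' (h i k hik), hik, absurd h'.symm (h k i hik)]
  intro i k hik hbik
  obtain ⟨x, hx, hxb⟩ := hb i
  obtain ⟨y, hy, hyb⟩ := hb k
  have hx0 := hlead i x hx hxb
  set r := (finRotate (m + 1)).symm (b i) with hr
  -- Equal leads would allow cancelling the leading coordinate of `y` while keeping it fresh.
  refine hlead k (y - (y r / x r) • x) (hy.sub hik (Submodule.smul_mem _ _ hx.mem)) ?_ ?_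
  · intro l hl
    simp [hyb l hl, hxb l (hbik ▸ hl)]
  · rw [← hbik, ← hr]
    simp [hx0]

/-- Every orbit contains a flag spanned by the vectors of an admissible word. -/
theorem exists_admissible (F : FullFlag (m + 1)) :
    ∃ w, IsAdmissible w ∧ ∃ g ∈ smallBorel m, ∀ F' : FullFlag (m + 1),
      F'.IsSpannedBy (wordVec w) → g • F' = F := by
  classical
  obtain ⟨a, ha, hfresh, hlead⟩ := exists_minimal_leads F
  choose u hu hua using hfresh
  -- `M i`: among the `u k` with nonzero last coordinate, `u i` sets a new minimum of the lead.
  let M : Fin (m + 1) → Prop := fun i => u i (Fin.last m) ≠ 0 ∧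
    ∀ k < i, u k (Fin.last m) ≠ 0 → key (a i) < key (a k)
  have hMlast : ∀ i, a i = Fin.last m → M i := fun i hi => by
    refine ⟨hi ▸ hlead i _ (hu i) (hua i), fun k hk _ => ?_⟩
    rw [hi, key_last]
    exact key_pos fun h => hk.ne (ha (h.trans hi.symm))
  let w : Fin (m + 1) → Fin (m + 1) × Bool := fun i => (a i, decide (M i ∧ a i ≠ Fin.last m))
  have hmark : ∀ i, Marked (w i) ↔ M i := fun i => by
    by_cases h : a i = Fin.last m
    · simp [w, Marked, h, hMlast i h]
    · simp [w, Marked, h]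
  have hw : IsAdmissible w := by
    refine ⟨ha, fun i hi => ?_, fun i k hik hi hk => ?_⟩
    · obtain ⟨h1, h2⟩ := Prod.ext_iff.1 hi
      simp only [w, decide_eq_true_eq] at h1 h2
      exact h2.2 h1
    · rw [hmark] at hi hk
      exact hk.2 i hik hi.1
  -- Rescale if `M i`. Otherwise a nonzero last coordinate is cancelled by an earlier `u k` of no
  -- larger lead, which preserves freshness and the bound on the lead.
  have hadj : ∀ i, ∃ x, F.Fresh i x ∧ LeadLE x (key (a i)) ∧
      x (Fin.last m) = if M i then 1 else 0 := by
    intro i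
    by_cases hMi : M i
    · exact ⟨(u i (Fin.last m))⁻¹ • u i, (hu i).smul (inv_ne_zero hMi.1),
        fun l hl => by simp [hua i l hl], by simp [hMi, hMi.1]⟩
    · by_cases h0 : u i (Fin.last m) = 0
      · exact ⟨u i, hu i, hua i, by simp [hMi, h0]⟩
      · obtain ⟨k, hk, hk0, hle⟩ : ∃ k < i, u k (Fin.last m) ≠ 0 ∧ key (a k) ≤ key (a i) := by
          by_contra! h
          exact hMi ⟨h0, h⟩
        exact ⟨u i - (u i (Fin.last m) / u k (Fin.last m)) • u k,
          (hu i).sub hk (Submodule.smul_mem _ _ (hu k).mem),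
          fun l hl => by simp [hua i l hl, hua k l (hle.trans_lt hl)], by simp [hMi, hk0]⟩
  choose v hv hva hvlast using hadj
  have hbij : Function.Bijective a := Finite.injective_iff_bijective.1 ha
  let e := Equiv.ofBijective a hbij
  have hae : ∀ l, a (e.symm l) = l := fun l => e.apply_symm_apply l
  have hea : ∀ i, e.symm (a i) = i := fun i => e.symm_apply_apply i
  -- Column `a i ≠ n` is `v i` with its last coordinate replaced by 0; the hat of a marked letter
  -- restores that coordinate, since `g₀` fixes `e_n`.
  let g₀ : Matrix (Fin (m + 1)) (Fin (m + 1)) ℂ := Matrix.of fun l c =>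
    if c = Fin.last m then stdVec (Fin.last m) l
    else if l = Fin.last m then 0 else v (e.symm c) l
  have htri : g₀.BlockTriangular id := by
    intro l c hcl
    change c < l at hcl
    have hc : c ≠ Fin.last m := fun h => absurd hcl (not_lt.2 (h ▸ Fin.le_last l))
    simp only [g₀, Matrix.of_apply, if_neg hc]
    split_ifs with hl
    · rfl
    · refine hva _ l ?_
      rw [hae, key_lt_key hc hl]
      exact hcl
  have hdet : IsUnit g₀.det := by
    rw [Matrix.det_of_isUpperTriangular htri, isUnit_iff_ne_zero, Finset.prod_ne_zero_iff]
    intro l _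
    by_cases hl : l = Fin.last m
    · simp [g₀, hl, stdVec]
    · have := hlead _ _ (hv (e.symm l)) (hva _)
      rw [hae] at this
      simpa [g₀, hl] using this
  let g : Matrix.GeneralLinearGroup (Fin (m + 1)) ℂ := Matrix.GeneralLinearGroup.mk'' g₀ hdet
  have hcol : ∀ c, g₀.mulVec (stdVec c) = fun l => g₀ l c := fun c => by
    funext l
    simp [stdVec]
  have hg : g ∈ smallBorel m := by
    refine ⟨⟨?_, ?_⟩, htri⟩
    · change g₀.mulVec _ = _
      rw [hcol]
      funext l
      simp [g₀]
    · change Matrix.vecMul _ g₀ = _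
      funext c
      by_cases hc : c = Fin.last m
      · simp [stdVec, g₀, hc]
      · simp [stdVec, g₀, hc, Pi.single_apply]
  have hgv : ∀ i, g₀.mulVec (wordVec w i) = v i := by
    intro i
    by_cases hi : a i = Fin.last m
    · have h2 : wordVec w i = stdVec (Fin.last m) := by simp [wordVec, letterVec, w, hi]
      rw [h2, hcol]
      funext l
      by_cases hl : l = Fin.last m
      · simp [g₀, hl, stdVec, hvlast, hMlast i hi]
      · have := hva i
        rw [hi, key_last, leadLE_zero_iff] at this
        simp [g₀, hl, stdVec, this l hl]
    · have h2 : wordVec w i = stdVec (a i) + if M i then stdVec (Fin.last m) else 0 := by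
        by_cases hMi : M i <;> simp [wordVec, letterVec, w, hi, hMi, hatVec]
      rw [h2, Matrix.mulVec_add, hcol]
      have h3 : g₀.mulVec (if M i then stdVec (Fin.last m) else 0) =
          if M i then stdVec (Fin.last m) else 0 := by
        split_ifs
        · exact hg.1.1
        · exact Matrix.mulVec_zero _
      rw [h3]
      funext l
      by_cases hl : l = Fin.last m
      · by_cases hMi : M i <;> simp [g₀, hl, hi, hvlast, hMi, stdVec]
      · by_cases hMi : M i <;> simp [g₀, hl, hi, hMi, stdVec, hea]
  refine ⟨w, hw, g, hg, fun F' hF' => (hF'.smul g).unique ?_⟩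
  have : (fun i => (g : Matrix (Fin (m + 1)) (Fin (m + 1)) ℂ).mulVec (wordVec w i)) = v :=
    funext hgv
  rw [this]
  exact FullFlag.isSpannedBy_of_fresh hv

/-! ### Hatted words and partitions into lists -/

/-- The word obtained from `σ_1 ⋯ σ_{t-1} τ` by putting a hat on the last letter of each `σ_i`,
where `L` lists the pairs (initial part of `σ_i`, last entry of `σ_i`). -/
def hatWord {α : Type*} (L : List (List α × α)) (τ : List α) : List (α × Bool) :=
  L.flatMap (fun p => p.1.map (fun a => (a, false)) ++ [(p.2, true)]) ++
    τ.map fun a => (a, false)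

section HatWord

variable {α : Type*}

theorem hatWord_cons (a : List α) (x : α) (L : List (List α × α)) (τ : List α) :
    hatWord ((a, x) :: L) τ = a.map (fun a => (a, false)) ++ (x, true) :: hatWord L τ := by
  simp [hatWord]

/-- Prepending a hatted letter opens a list with empty initial part; prepending an unhatted one
lengthens the first list, which is `τ` if there are no hats. -/
theorem exists_hatWord_eq (l : List (α × Bool)) : ∃ L τ, hatWord L τ = l := by
  induction l with
  | nil => exact ⟨[], [], rfl⟩
  | cons x l ih =>
    obtain ⟨L, τ, rfl⟩ := ih
    obtain ⟨a, b⟩ := x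
    cases b with
    | true => exact ⟨([], a) :: L, τ, by simp [hatWord_cons]⟩
    | false =>
      cases L with
      | nil => exact ⟨[], a :: τ, by simp [hatWord]⟩
      | cons p L =>
        obtain ⟨b, x⟩ := p
        exact ⟨(a :: b, x) :: L, τ, by simp [hatWord_cons]⟩

theorem split_first_hat {a a' : List α} {x x' : α} {r r' : List (α × Bool)}
    (h : a.map (fun a => (a, false)) ++ (x, true) :: r =
      a'.map (fun a => (a, false)) ++ (x', true) :: r') : a = a' ∧ x = x' ∧ r = r' := by
  induction a generalizing a' with
  | nil => cases a' <;> simp_all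
  | cons y a ih =>
    cases a' with
    | nil => simp at h
    | cons y' a' =>
      simp only [List.map_cons, List.cons_append, List.cons.injEq, Prod.mk.injEq, and_true] at h
      obtain ⟨rfl, h2, h3⟩ := ih h.2
      exact ⟨by rw [h.1], h2, h3⟩

theorem hatWord_injective {L L' : List (List α × α)} {τ τ' : List α}
    (h : hatWord L τ = hatWord L' τ') : L = L' ∧ τ = τ' := by
  have hne : ∀ (p : List α × α) (L : List (List α × α)) (τ τ' : List α),
      hatWord (p :: L) τ ≠ hatWord [] τ' := fun p L τ τ' h => by
    have : (p.2, true) ∈ hatWord [] τ' := by rw [← h]; simp [hatWord]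
    simp [hatWord] at this
  induction L generalizing L' with
  | nil =>
    cases L' with
    | nil =>
      refine ⟨rfl, ?_⟩
      have hinj : Function.Injective fun a : α => (a, false) := fun a b h => (Prod.ext_iff.1 h).1
      exact hinj.list_map (by simpa [hatWord] using h)
    | cons p L' => exact absurd h.symm (hne p L' _ _)
  | cons p L ih =>
    cases L' with
    | nil => exact absurd h (hne p L _ _)
    | cons p' L' =>
      obtain ⟨a, x⟩ := p
      obtain ⟨a', x'⟩ := p'
      rw [hatWord_cons, hatWord_cons] at h
      obtain ⟨rfl, rfl, hr⟩ := split_first_hat h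
      obtain ⟨rfl, rfl⟩ := ih hr
      exact ⟨rfl, rfl⟩

theorem map_fst_hatWord (L : List (List α × α)) (τ : List α) :
    (hatWord L τ).map Prod.fst = (L.map (fun p => p.1 ++ [p.2]) ++ [τ]).flatten := by
  induction L with
  | nil => simp [hatWord, Function.comp_def]
  | cons p L ih =>
    obtain ⟨a, x⟩ := p
    rw [hatWord_cons]
    simp [ih, Function.comp_def]

theorem exists_ofFn_eq {n : ℕ} {l : List α} (h : l.length = n) :
    ∃ w : Fin n → α, List.ofFn w = l := by
  subst h
  exact ⟨l.get, List.ofFn_get l⟩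

end HatWord

namespace PIL

variable {n : ℕ}

theorem mem_lists_iff {S : PIL n} {M : List (List (Fin n))}
    (h : S.lists.val = (M : Multiset (List (Fin n)))) {σ : List (Fin n)} :
    σ ∈ S.lists ↔ σ ∈ M := by
  rw [← Finset.mem_val, h, Multiset.mem_coe]

theorem nodup_flatten {S : PIL n} {M : List (List (Fin n))}
    (h : S.lists.val = (M : Multiset (List (Fin n)))) : M.flatten.Nodup := by
  have hM : M.Nodup := by
    have := S.lists.nodup
    rwa [h, Multiset.coe_nodup] at this
  refine List.nodup_flatten.2 ⟨fun σ hσ => S.nodup σ ((mem_lists_iff h).2 hσ), ?_⟩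
  refine List.Pairwise.imp_of_mem (fun {σ σ'} hσ hσ' hne a ha ha' => hne ?_) hM
  exact (S.existsUnique_mem a).unique ⟨(mem_lists_iff h).2 hσ, ha⟩ ⟨(mem_lists_iff h).2 hσ', ha'⟩

theorem mem_flatten {S : PIL n} {M : List (List (Fin n))}
    (h : S.lists.val = (M : Multiset (List (Fin n)))) (a : Fin n) : a ∈ M.flatten := by
  obtain ⟨σ, ⟨hσ, ha⟩, -⟩ := S.existsUnique_mem a
  exact List.mem_flatten.2 ⟨σ, (mem_lists_iff h).1 hσ, ha⟩

/-- Nonempty disjoint lists are distinct, so `M` has no repetitions and underlies a finset. -/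
theorem exists_of_flatten {M : List (List (Fin n))} (hne : ∀ σ ∈ M, σ ≠ [])
    (hnodup : M.flatten.Nodup) (hmem : ∀ a, a ∈ M.flatten) :
    ∃ S : PIL n, S.lists.val = (M : Multiset (List (Fin n))) := by
  obtain ⟨h1, h2⟩ := List.nodup_flatten.1 hnodup
  have hM : M.Nodup := by
    refine List.Pairwise.imp_of_mem (fun {σ σ'} hσ _ hd he => ?_) h2
    subst he
    obtain ⟨a, ha⟩ := List.exists_mem_of_ne_nil σ (hne σ hσ)
    exact hd ha ha
  refine ⟨⟨⟨M, hM⟩, hne, h1, fun a => ?_⟩, rfl⟩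
  obtain ⟨σ, hσ, ha⟩ := List.mem_flatten.1 (hmem a)
  refine ⟨σ, ⟨hσ, ha⟩, fun σ' hσ' => ?_⟩
  by_contra hne'
  have : Std.Symm (List.Disjoint (α := Fin n)) := ⟨fun _ _ h => h.symm⟩
  exact h2.forall hσ hσ'.1 (Ne.symm hne') ha hσ'.2

/-- The lists of a partition into lists can be ordered as required. -/
theorem exists_ordering (S : PIL (m + 1)) :
    ∃ (L : List (List (Fin (m + 1)) × Fin (m + 1))) (τ : List (Fin (m + 1))),
      S.lists.val = ((L.map (fun p => p.1 ++ [p.2]) ++ [τ] : List (List (Fin (m + 1)))) :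
        Multiset (List (Fin (m + 1)))) ∧
      Fin.last m ∈ τ ∧ L.Pairwise (fun p q => q.2 < p.2) := by
  classical
  obtain ⟨τ, ⟨hτ, hlast⟩, -⟩ := S.existsUnique_mem (Fin.last m)
  let r : List (Fin (m + 1)) × Fin (m + 1) → List (Fin (m + 1)) × Fin (m + 1) → Prop :=
    fun p q => q.2 ≤ p.2
  have : Std.Total r := ⟨fun p q => le_total q.2 p.2⟩
  have : IsTrans _ r := ⟨fun p q s h h' => le_trans h' h⟩
  let N := (S.lists.erase τ).toList
  -- The default `Fin.last m` is never used: the lists in `N` are nonempty.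
  let L₀ := N.map fun σ => (σ.dropLast, σ.getLast?.getD (Fin.last m))
  have hL₀ : L₀.map (fun p => p.1 ++ [p.2]) = N := by
    rw [List.map_map]
    refine (List.map_congr_left fun σ hσ => ?_).trans (List.map_id N)
    have hne : σ ≠ [] := S.ne_nil σ (Finset.mem_of_mem_erase (Finset.mem_toList.1 hσ))
    simp [List.getLast?_eq_getLast_of_ne_nil hne, List.dropLast_append_getLast]
  have hperm : (L₀.insertionSort r).Perm L₀ := List.perm_insertionSort r L₀
  have hval : S.lists.val = (((L₀.insertionSort r).map (fun p => p.1 ++ [p.2]) ++ [τ] :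
      List (List (Fin (m + 1)))) : Multiset (List (Fin (m + 1)))) := by
    rw [Multiset.coe_eq_coe.2 ((hperm.map _).append_right [τ]), hL₀, ← Multiset.coe_add,
      Finset.coe_toList, Finset.erase_val, Multiset.coe_singleton, add_comm (Multiset.erase _ _),
      Multiset.singleton_add, Multiset.cons_erase hτ]
  refine ⟨L₀.insertionSort r, τ, hval, hlast, ?_⟩
  -- Sorting gives weak decrease; disjointness of the lists makes it strict.
  have hdisj := (List.pairwise_append.1 (List.nodup_flatten.1 (nodup_flatten hval)).2).1
  rw [List.pairwise_map] at hdisj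
  refine ((List.pairwise_insertionSort r L₀).and hdisj).imp fun {p q} h => ?_
  refine lt_of_le_of_ne h.1 fun he => h.2 (show p.2 ∈ p.1 ++ [p.2] by simp) (by simp [he])

theorem ordering_unique {S : PIL (m + 1)} {L L' : List (List (Fin (m + 1)) × Fin (m + 1))}
    {τ τ' : List (Fin (m + 1))}
    (h : S.lists.val = ((L.map (fun p => p.1 ++ [p.2]) ++ [τ] : List (List (Fin (m + 1)))) :
        Multiset (List (Fin (m + 1)))))
    (hτ : Fin.last m ∈ τ) (hL : L.Pairwise (fun p q => q.2 < p.2))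
    (h' : S.lists.val = ((L'.map (fun p => p.1 ++ [p.2]) ++ [τ'] : List (List (Fin (m + 1)))) :
        Multiset (List (Fin (m + 1)))))
    (hτ' : Fin.last m ∈ τ') (hL' : L'.Pairwise (fun p q => q.2 < p.2)) : L = L' ∧ τ = τ' := by
  have he : τ = τ' := (S.existsUnique_mem (Fin.last m)).unique
    ⟨(mem_lists_iff h).2 (by simp), hτ⟩ ⟨(mem_lists_iff h').2 (by simp), hτ'⟩
  subst he
  refine ⟨?_, rfl⟩
  have hp := Multiset.coe_eq_coe.1 (h.symm.trans h')
  rw [List.perm_append_right_iff, List.map_perm_map_iff] at hp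
  · exact hp.eq_of_pairwise (fun p q _ _ h1 h2 => absurd h1 h2.asymm) hL hL'
  · intro p q hpq
    obtain ⟨h1, h2⟩ := List.append_inj' hpq rfl
    exact Prod.ext h1 (by simpa using h2)

end PIL

/-! ### Admissible words correspond to partitions into lists -/

/-- The word `w` is the one attached to the partition into lists `S`. -/
def IsWordOfPIL (S : PIL (m + 1)) (w : Fin (m + 1) → Fin (m + 1) × Bool) : Prop :=
  ∃ (L : List (List (Fin (m + 1)) × Fin (m + 1))) (τ : List (Fin (m + 1))),
    S.lists.val = ((L.map (fun p => p.1 ++ [p.2]) ++ [τ] : List (List (Fin (m + 1)))) :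
      Multiset (List (Fin (m + 1)))) ∧
    Fin.last m ∈ τ ∧ L.Pairwise (fun p q => q.2 < p.2) ∧ List.ofFn w = hatWord L τ

theorem exists_word_eq_hatWord {S : PIL (m + 1)}
    {L : List (List (Fin (m + 1)) × Fin (m + 1))} {τ : List (Fin (m + 1))}
    (h : S.lists.val = ((L.map (fun p => p.1 ++ [p.2]) ++ [τ] : List (List (Fin (m + 1)))) :
      Multiset (List (Fin (m + 1))))) :
    ∃ w : Fin (m + 1) → Fin (m + 1) × Bool, List.ofFn w = hatWord L τ := by
  refine exists_ofFn_eq ?_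
  rw [← List.length_map (f := Prod.fst), map_fst_hatWord,
    ← List.toFinset_card_of_nodup (PIL.nodup_flatten h),
    Finset.eq_univ_iff_forall.2 fun a => List.mem_toFinset.2 (PIL.mem_flatten h a),
    Finset.card_univ, Fintype.card_fin]

theorem exists_isWordOfPIL (S : PIL (m + 1)) : ∃ w, IsWordOfPIL S w := by
  obtain ⟨L, τ, h, hτ, hL⟩ := S.exists_ordering
  obtain ⟨w, hw⟩ := exists_word_eq_hatWord h
  exact ⟨w, L, τ, h, hτ, hL, hw⟩

theorem IsWordOfPIL.word_unique {S : PIL (m + 1)} {w w' : Fin (m + 1) → Fin (m + 1) × Bool}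
    (hw : IsWordOfPIL S w) (hw' : IsWordOfPIL S w') : w = w' := by
  obtain ⟨L, τ, h, hτ, hL, hLw⟩ := hw
  obtain ⟨L', τ', h', hτ', hL', hLw'⟩ := hw'
  obtain ⟨rfl, rfl⟩ := PIL.ordering_unique h hτ hL h' hτ' hL'
  exact List.ofFn_injective (hLw.trans hLw'.symm)

theorem IsWordOfPIL.pil_unique {S S' : PIL (m + 1)} {w : Fin (m + 1) → Fin (m + 1) × Bool}
    (hw : IsWordOfPIL S w) (hw' : IsWordOfPIL S' w) : S = S' := by
  obtain ⟨L, τ, h, hτ, hL, hLw⟩ := hw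
  obtain ⟨L', τ', h', hτ', hL', hLw'⟩ := hw'
  obtain ⟨rfl, rfl⟩ := hatWord_injective (hLw.symm.trans hLw')
  exact PIL.ext (Finset.val_injective (h.trans h'.symm))

/-- Since `n` lies in `τ`, the only marked letter of another list is its final hat, and the only one
of `τ` is `e_n`, whose key is least. -/
theorem IsWordOfPIL.isAdmissible {S : PIL (m + 1)} {w : Fin (m + 1) → Fin (m + 1) × Bool}
    (hw : IsWordOfPIL S w) : IsAdmissible w := by
  obtain ⟨L, τ, h, hτ, hL, hLw⟩ := hw
  have hnodup := PIL.nodup_flatten h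
  obtain ⟨hnd, hdisj⟩ := List.nodup_flatten.1 hnodup
  have hlast : ∀ p ∈ L, Fin.last m ∉ p.1 ++ [p.2] := fun p hp hm =>
    (List.pairwise_append.1 hdisj).2.2 _ (List.mem_map_of_mem hp) τ (by simp) hm hτ
  have hlast2 : ∀ p ∈ L, p.2 ≠ Fin.last m := fun p hp he => hlast p hp (by simp [he])
  have hmarked : ∀ p ∈ L, ∀ x ∈ p.1.map (fun a => (a, false)) ++ [(p.2, true)],
      Marked x → x = (p.2, true) := by
    intro p hp x hx hmx
    rcases List.mem_append.1 hx with hx | hx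
    · obtain ⟨a, ha, rfl⟩ := List.mem_map.1 hx
      have : a = Fin.last m := by simpa [Marked] using hmx
      exact absurd (by simp [← this, ha]) (hlast p hp)
    · simpa using hx
  have hpw : (List.ofFn w).Pairwise fun x y => Marked x → Marked y → key y.1 < key x.1 := by
    rw [hLw]
    refine List.pairwise_append.2 ⟨List.pairwise_flatMap.2 ⟨fun p hp => ?_, ?_⟩, ?_, ?_⟩
    · refine List.pairwise_append.2 ⟨?_, List.pairwise_singleton _ _, ?_⟩
      · refine List.pairwise_map.2 (List.pairwise_of_forall_mem_list fun a ha b _ hma _ => ?_)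
        have := hmarked p hp (a, false) (by simp [ha]) hma
        simp at this
      · intro x hx y _ hmx _
        have := hmarked p hp x (List.mem_append_left _ hx) hmx
        subst this
        simp at hx
    · refine hL.imp_of_mem fun {p q} hp hq hpq x hx y hy hmx hmy => ?_
      rw [hmarked p hp x hx hmx, hmarked q hq y hy hmy]
      exact (key_lt_key (hlast2 q hq) (hlast2 p hp)).2 hpq
    · refine List.pairwise_map.2 ((hnd τ (by simp)).imp fun {a b} hab hma hmb => ?_)
      simp only [Marked, Bool.false_eq_true, false_or] at hma hmb
      exact absurd (hma.trans hmb.symm) hab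
    · intro x hx y hy hmx hmy
      obtain ⟨p, hp, hx⟩ := List.mem_flatMap.1 hx
      obtain ⟨b, -, rfl⟩ := List.mem_map.1 hy
      have hb : b = Fin.last m := by simpa [Marked] using hmy
      rw [hmarked p hp x hx hmx, hb, key_last]
      exact key_pos (hlast2 p hp)
  refine ⟨?_, fun i hi => ?_, fun i k hik => List.pairwise_ofFn.1 hpw hik⟩
  · rw [← map_fst_hatWord, ← hLw, List.map_ofFn] at hnodup
    exact List.nodup_ofFn.1 hnodup
  · have : w i ∈ hatWord L τ := by rw [← hLw]; exact List.mem_ofFn.2 ⟨i, rfl⟩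
    rw [hi] at this
    rcases List.mem_append.1 this with h' | h'
    · obtain ⟨p, hp, hx⟩ := List.mem_flatMap.1 h'
      have := hmarked p hp _ hx (Or.inl rfl)
      exact hlast2 p hp (Prod.ext_iff.1 this).1.symm
    · simp at h'

theorem IsAdmissible.exists_isWordOfPIL {w : Fin (m + 1) → Fin (m + 1) × Bool}
    (hw : IsAdmissible w) : ∃ S, IsWordOfPIL S w := by
  obtain ⟨L, τ, hLw⟩ := exists_hatWord_eq (List.ofFn w)
  have hflat : (L.map (fun p => p.1 ++ [p.2]) ++ [τ]).flatten = List.ofFn fun i => (w i).1 := by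
    rw [← map_fst_hatWord, hLw, List.map_ofFn]
    rfl
  have hpw : (hatWord L τ).Pairwise fun x y => Marked x → Marked y → key y.1 < key x.1 := by
    rw [hLw]
    exact List.pairwise_ofFn.2 fun i k hik => hw.anti i k hik
  obtain ⟨hpw1, hpw2⟩ := List.pairwise_flatMap.1 (List.pairwise_append.1 hpw).1
  have hlast2 : ∀ p ∈ L, p.2 ≠ Fin.last m := fun p hp he => by
    have : (p.2, true) ∈ List.ofFn w := by
      rw [← hLw]
      exact List.mem_append_left _ (List.mem_flatMap.2 ⟨p, hp, by simp⟩)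
    obtain ⟨i, hi⟩ := List.mem_ofFn.1 this
    exact hw.ne_hat_last i (by rw [hi, he])
  have hmem : ∀ a, a ∈ (L.map (fun p => p.1 ++ [p.2]) ++ [τ]).flatten := fun a => by
    rw [hflat]
    exact List.mem_ofFn.2 (hw.bijective.2 a)
  have hτ : Fin.last m ∈ τ := by
    obtain ⟨σ, hσ, hl⟩ := List.mem_flatten.1 (hmem (Fin.last m))
    rcases List.mem_append.1 hσ with hσ | hσ
    · obtain ⟨p, hp, rfl⟩ := List.mem_map.1 hσ
      rcases List.mem_append.1 hl with hl | hl
      -- An `e_n` inside a hatted list would precede a marked letter, whose key would have to be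
      -- below 0.
      · have := (List.pairwise_append.1 (hpw1 p hp)).2.2 (Fin.last m, false) (by simpa using hl)
          (p.2, true) (by simp) (Or.inr rfl) (Or.inl rfl)
        rw [key_last] at this
        exact absurd this (Fin.not_lt_zero _)
      · exact absurd (by simpa using hl : Fin.last m = p.2).symm (hlast2 p hp)
    · rwa [List.mem_singleton.1 hσ] at hl
  obtain ⟨S, hS⟩ := PIL.exists_of_flatten (M := L.map (fun p => p.1 ++ [p.2]) ++ [τ]) (by
      intro σ hσ
      rcases List.mem_append.1 hσ with hσ | hσ
      · obtain ⟨p, -, rfl⟩ := List.mem_map.1 hσ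
        simp
      · rw [List.mem_singleton.1 hσ]
        exact List.ne_nil_of_mem hτ)
    (by rw [hflat]; exact List.nodup_ofFn.2 hw.inj) hmem
  refine ⟨S, L, τ, hS, hτ, hpw2.imp_of_mem fun {p q} hp hq h => ?_, hLw.symm⟩
  exact (key_lt_key (hlast2 q hq) (hlast2 p hp)).1
    (h (p.2, true) (by simp) (q.2, true) (by simp) (Or.inl rfl) (Or.inl rfl))

theorem isFlagOfPIL_iff {S : PIL (m + 1)} {F : FullFlag (m + 1)} :
    IsFlagOfPIL S F ↔ ∃ w, IsWordOfPIL S w ∧ F.IsSpannedBy (wordVec w) := by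
  have hmap : ∀ (L : List (List (Fin (m + 1)) × Fin (m + 1))) (τ : List (Fin (m + 1)))
      (w : Fin (m + 1) → Fin (m + 1) × Bool), List.ofFn w = hatWord L τ →
      List.ofFn (wordVec w) =
        L.flatMap (fun p => p.1.map stdVec ++ [hatVec p.2]) ++ τ.map stdVec := by
    intro L τ w hw
    have : List.ofFn (wordVec w) = (List.ofFn w).map letterVec := by
      rw [List.map_ofFn]
      rfl
    rw [this, hw]
    simp [hatWord, List.map_flatMap, letterVec, Function.comp_def]
  constructor
  · rintro ⟨L, τ, v, h, hτ, hL, hv, hF⟩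
    obtain ⟨w, hw⟩ := exists_word_eq_hatWord h
    refine ⟨w, ⟨L, τ, h, hτ, hL, hw⟩, ?_⟩
    rwa [List.ofFn_injective ((hmap L τ w hw).trans hv.symm)]
  · rintro ⟨w, ⟨L, τ, h, hτ, hL, hw⟩, hF⟩
    exact ⟨L, τ, wordVec w, h, hτ, hL, hmap L τ w hw, hF⟩

/-! ### Standard flags are the flags of admissible words -/

theorem IsAdmissible.isStandard {w : Fin (m + 1) → Fin (m + 1) × Bool} (hw : IsAdmissible w)
    {F : FullFlag (m + 1)} (hF : F.IsSpannedBy (wordVec w)) : IsStandard F := by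
  classical
  have hnot : ∀ i, (w i).2 = true → (w i).1 ≠ Fin.last m := fun i h h' =>
    hw.ne_hat_last i (Prod.ext h' h)
  have hstd : ∀ i, wordVec w i = stdVec (Fin.last m) → (w i).1 = Fin.last m := by
    intro i hi
    by_contra h
    have := congrFun hi (w i).1
    rw [wordVec, letterVec_apply_of_ne _ h] at this
    simp [stdVec, h] at this
  have hhat : ∀ i j, j < Fin.last m → wordVec w i = hatVec j → (w i).1 = j ∧ Marked (w i) := by
    intro i j hj hi
    constructor
    · by_contra h
      have := congrFun hi j
      rw [wordVec, letterVec_apply_of_ne _ hj.ne, if_neg h] at this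
      simp [hatVec, stdVec, hj.ne] at this
    · by_contra h
      have := congrFun hi (Fin.last m)
      rw [wordVec, letterVec_apply_last (hw.ne_hat_last i), if_neg h] at this
      simp [hatVec, stdVec, hj.ne'] at this
  refine ⟨wordVec w, hF, fun i => ?_, ?_, fun i k hi hik => ?_, fun i k hik j l hj hl hi hk => ?_⟩
  · rcases hb : (w i).2 with _ | _
    · exact Or.inl ⟨(w i).1, by simp [wordVec, letterVec, hb]⟩
    · exact Or.inr ⟨(w i).1, Fin.lt_last_iff_ne_last.2 (hnot i hb), by
        simp [wordVec, letterVec, hb]⟩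
  · obtain ⟨i, hi⟩ := hw.bijective.2 (Fin.last m)
    refine ⟨i, ?_⟩
    have hb : (w i).2 = false := by
      by_contra h
      exact hnot i (by simpa using h) hi
    dsimp only at hi
    simp [wordVec, letterVec, hb, hi]
  · have hi' := hstd i hi
    refine ⟨(w k).1, ?_⟩
    have hb : (w k).2 = false := by
      by_contra h
      have := hw.anti i k hik (Or.inr hi') (Or.inl (by simpa using h))
      rw [hi', key_last] at this
      exact Fin.not_lt_zero _ this
    simp [wordVec, letterVec, hb]
  · obtain ⟨rfl, hmi⟩ := hhat i j hj hi
    obtain ⟨rfl, hmk⟩ := hhat k l hl hk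
    exact (key_lt_key hl.ne hj.ne).1 (hw.anti i k hik hmi hmk)

theorem FullFlag.V_last (F : FullFlag (m + 1)) : F.V (Fin.last m) = ⊤ := by
  refine Submodule.eq_top_of_finrank_eq ?_
  rw [F.finrank_eq]
  simp

/-- The `v i` span the whole space, so every index below `n` occurs; `n` occurs by (a). A surjection
between finite sets of equal size is injective. -/
theorem IsStandard.exists_word {F : FullFlag (m + 1)} (hF : IsStandard F) :
    ∃ w, IsAdmissible w ∧ F.IsSpannedBy (wordVec w) := by
  classical
  obtain ⟨v, hv, hform, ⟨p, hp⟩, hafter, hdecr⟩ := hF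
  have hletter : ∀ i, ∃ x : Fin (m + 1) × Bool, x ≠ (Fin.last m, true) ∧ letterVec x = v i := by
    intro i
    rcases hform i with ⟨j, hj⟩ | ⟨j, hj, hj'⟩
    · exact ⟨(j, false), by simp, by simp [letterVec, hj]⟩
    · exact ⟨(j, true), by simp [hj.ne], by simp [letterVec, hj']⟩
  choose w hw hwv using hletter
  have hwv' : wordVec w = v := funext hwv
  have hlast : ∀ i, v i = stdVec (Fin.last m) → (w i).1 = Fin.last m := by
    intro i hi
    by_contra h
    have := congrFun hi (w i).1
    rw [← hwv, letterVec_apply_of_ne _ h] at this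
    simp [stdVec, h] at this
  have hsurj : Function.Surjective fun i => (w i).1 := by
    intro a
    rcases eq_or_ne a (Fin.last m) with rfl | ha
    · exact ⟨p, hlast p hp⟩
    · by_contra! hne
      have hmem : stdVec a ∈ F.V (Fin.last m) := by rw [F.V_last]; trivial
      obtain ⟨c, -, hc⟩ := hv.mem_iff.1 hmem
      have := congrFun hc a
      rw [Finset.sum_apply, Finset.sum_eq_zero fun k _ => by
        rw [Pi.smul_apply, ← hwv, letterVec_apply_of_ne _ ha, if_neg (hne k), smul_zero]] at this
      simp [stdVec] at this
  have hinj : Function.Injective fun i => (w i).1 := Finite.injective_iff_surjective.2 hsurj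
  have hstd : ∀ i, (w i).1 = Fin.last m → v i = stdVec (Fin.last m) := by
    intro i hi
    have : i = p := hinj (hi.trans (hlast p hp).symm)
    rw [this, hp]
  have hhat : ∀ i, (w i).1 ≠ Fin.last m → Marked (w i) → v i = hatVec (w i).1 := by
    intro i hi hm
    have hb : (w i).2 = true := hm.resolve_right hi
    rw [← hwv]
    simp [letterVec, hb]
  refine ⟨w, ⟨hinj, hw, fun i k hik hi hk => ?_⟩, hwv' ▸ hv⟩
  by_cases hi' : (w i).1 = Fin.last m
  · exfalso
    have hk' : (w k).1 ≠ Fin.last m := fun h => hik.ne (hinj (hi'.trans h.symm))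
    -- By (b) the hat vector `v k` would be a standard basis vector, but it has two nonzero
    -- coordinates.
    obtain ⟨j, hj⟩ := hafter i k (hstd i hi') hik
    have h1 := hhat k hk' hk
    have h2 := congrFun (h1.symm.trans hj) (Fin.last m)
    have h3 := congrFun (h1.symm.trans hj) (w k).1
    have h4 : j = Fin.last m := by
      by_contra h
      simp [hatVec, stdVec, Ne.symm hk', Ne.symm h] at h2
    subst h4
    simp [hatVec, stdVec, hk'] at h3
  · by_cases hk' : (w k).1 = Fin.last m
    · rw [hk', key_last]
      exact key_pos hi'
    · exact (key_lt_key hk' hi').2 (hdecr i k hik _ _ (Fin.lt_last_iff_ne_last.2 hi')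
        (Fin.lt_last_iff_ne_last.2 hk') (hhat i hi' hi) (hhat k hk' hk))

/-! ### The bijections -/

theorem exists_standard_mem_orbit (F : FullFlag (m + 1)) :
    ∃ F' ∈ MulAction.orbit (smallBorel m) F, IsStandard F' := by
  obtain ⟨w, hw, g, hg, h⟩ := exists_admissible F
  obtain ⟨F', hF'⟩ := FullFlag.exists_isSpannedBy hw.linearIndependent
  refine ⟨F', ⟨⟨g, hg⟩⁻¹, ?_⟩, hw.isStandard hF'⟩
  change (⟨g, hg⟩ : smallBorel m)⁻¹ • F = F'
  rw [inv_smul_eq_iff]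
  exact (h F' hF').symm

theorem IsStandard.eq_of_mem_orbit {F F' : FullFlag (m + 1)} (hF : IsStandard F)
    (hF' : IsStandard F') (h : F' ∈ MulAction.orbit (smallBorel m) F) : F' = F := by
  obtain ⟨w, hw, hwF⟩ := hF.exists_word
  obtain ⟨w', hw', hwF'⟩ := hF'.exists_word
  obtain ⟨g, rfl⟩ := h
  have := hw.word_unique hw' g.2 hwF hwF'
  subst this
  exact hwF'.unique hwF

theorem toOrbit_bijective : Function.Bijective (toOrbit : StandardFlag m → Orbits m) := by
  constructor
  · intro F F' h
    exact Subtype.ext (F'.2.eq_of_mem_orbit F.2 (Quotient.exact h))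
  · intro q
    induction q using Quotient.inductionOn with
    | h F =>
      obtain ⟨F', hF', hs⟩ := exists_standard_mem_orbit F
      exact ⟨⟨F', hs⟩, Quotient.sound hF'⟩

theorem existsUnique_isFlagOfPIL (S : PIL (m + 1)) : ∃! F, IsFlagOfPIL S F := by
  obtain ⟨w, hw⟩ := exists_isWordOfPIL S
  obtain ⟨F, hF⟩ := FullFlag.exists_isSpannedBy hw.isAdmissible.linearIndependent
  refine ⟨F, isFlagOfPIL_iff.2 ⟨w, hw, hF⟩, fun F' hF' => ?_⟩
  obtain ⟨w', hw', hF'⟩ := isFlagOfPIL_iff.1 hF'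
  rw [← hw.word_unique hw'] at hF'
  exact hF'.unique hF

theorem IsFlagOfPIL.isStandard {S : PIL (m + 1)} {F : FullFlag (m + 1)} (h : IsFlagOfPIL S F) :
    IsStandard F := by
  obtain ⟨w, hw, hF⟩ := isFlagOfPIL_iff.1 h
  exact hw.isAdmissible.isStandard hF

theorem IsStandard.exists_isFlagOfPIL {F : FullFlag (m + 1)} (hF : IsStandard F) :
    ∃ S, IsFlagOfPIL S F := by
  obtain ⟨w, hw, hwF⟩ := hF.exists_word
  obtain ⟨S, hS⟩ := hw.exists_isWordOfPIL
  exact ⟨S, isFlagOfPIL_iff.2 ⟨w, hS, hwF⟩⟩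

theorem IsFlagOfPIL.pil_unique {S S' : PIL (m + 1)} {F : FullFlag (m + 1)}
    (h : IsFlagOfPIL S F) (h' : IsFlagOfPIL S' F) : S = S' := by
  obtain ⟨w, hw, hF⟩ := isFlagOfPIL_iff.1 h
  obtain ⟨w', hw', hF'⟩ := isFlagOfPIL_iff.1 h'
  -- With `g = 1`, uniqueness in an orbit says that a flag determines its word.
  have := hw.isAdmissible.word_unique hw'.isAdmissible (one_mem (smallBorel m)) hF
    (by rwa [one_smul])
  subst this
  exact hw.pil_unique hw'

end StdFlags

/-- For `n = m + 1 ≥ 1`: every `B_{n-1}`-orbit on the full flags of `ℂ^n` contains exactly one flag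
in standard form; `F ↦ B_{n-1} · F` is a bijection from flags in standard form to orbits; and the
explicit assignment `Γ` of a flag to a partition into lists is a bijection from `PIL(n)` to flags
in standard form, so that `S ↦ B_{n-1} · Γ(S)` is a bijection from `PIL(n)` to orbits. -/
theorem mainTheorem5 (m : ℕ) :
    (∀ F : StdFlags.FullFlag (m + 1),
      ∃! F' : StdFlags.FullFlag (m + 1),
        F' ∈ MulAction.orbit (StdFlags.smallBorel m) F ∧ StdFlags.IsStandard F') ∧
    Function.Bijective (StdFlags.toOrbit : StdFlags.StandardFlag m → StdFlags.Orbits m) ∧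
    (∃ Γ : StdFlags.PIL (m + 1) → StdFlags.StandardFlag m,
      (∀ (S : StdFlags.PIL (m + 1)) (F : StdFlags.FullFlag (m + 1)),
        StdFlags.IsFlagOfPIL S F ↔ F = (Γ S).1) ∧
      Function.Bijective Γ ∧
      Function.Bijective (fun S => StdFlags.toOrbit (Γ S))) := by
  refine ⟨fun F => ?_, StdFlags.toOrbit_bijective, ?_⟩
  · obtain ⟨F', hF', hs⟩ := StdFlags.exists_standard_mem_orbit F
    refine ⟨F', ⟨hF', hs⟩, fun F'' h => hs.eq_of_mem_orbit h.2 ?_⟩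
    rw [MulAction.orbit_eq_iff.2 hF']
    exact h.1
  · choose f hf hfu using fun S : StdFlags.PIL (m + 1) => StdFlags.existsUnique_isFlagOfPIL S
    have hbij : Function.Bijective fun S => (⟨f S, (hf S).isStandard⟩ : StdFlags.StandardFlag m) := by
      refine ⟨fun S S' h => ?_, fun F => ?_⟩
      · have h' : f S = f S' := congrArg Subtype.val h
        exact (hf S).pil_unique (h' ▸ hf S')
      · obtain ⟨S, hS⟩ := F.2.exists_isFlagOfPIL
        exact ⟨S, Subtype.ext (hfu S F.1 hS).symm⟩
    exact ⟨_, fun S F => ⟨hfu S F, fun h => h ▸ hf S⟩, hbij, StdFlags.toOrbit_bijective.comp hbij⟩
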